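/- All graphs are finite and simple; $\chi$ denotes the chromatic number, $[k]=\{1,\dots,k\}$, and $K_t$ is the complete graph on $t$ vertices. The join $G\vee H$ is obtained from disjoint copies of $G$ and $H$ by making every vertex of $G$ adjacent to every vertex of $H$. A graph $G$ is $k$-critical if $\chi(G)=k$ and $\chi(G')<k$ for every proper subgraph $G'$ of $G$. A cover of a graph $G$ is a pair $\mathcal H=(L,H)$, where $H$ is a graph and $L$ assigns to each $v\in V(G)$ a set $L(v)\subseteq V(H)$ such that the sets $L(v)$ are pairwise disjoint, independent in $H$, and have union $V(H)$, and such that whenever there is an edge of $H$ between $L(u)$ and $L(v)$, we have $uv\in E(G)$ and the edges of $H$ between $L(u)$ and $L(v)$ form a (not necessarily perfect) matching. The graph $G$ is $\mathcal H$-colorable if $H$ has an independent set containing exactly one vertex of each $L(v)$; otherwise $\mathcal H$ is bad. The cover is $k$-fold if $|L(v)|=k$ for all $v\in V(G)$. The DP-chromatic number $\chi_{\mathsf{DP}}(G)$ is the least $k$ such that $G$ is $\mathcal H$-colorable for every $k$-fold cover $\mathcal H$ of $G$. A $k$-fold cover $\mathcal H=(L,H)$ of $G$ is canonical if there is a map $\lambda\colon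 V(H)\to[k]$ that restricts to a bijection $L(v)\to[k]$ for each $v\in V(G)$ and is such that for all $uv\in E(G)$, $c\in L(u)$, $c'\in L(v)$, we have $cc'\in E(H)$ if and only if $\lambda(c)=\lambda(c')$. A graph $G$ is robustly $k$-critical, for $k\ge 1$, if it is $k$-critical and every bad $(k-1)$-fold cover of $G$ is canonical; it is robustly critical if it is robustly $k$-critical for some $k\ge 1$. **Lemma.** Let $G$ be a nonempty $n$-vertex $k$-critical graph with $\chi_{\mathsf{DP}}(G)=k$. Then $G\vee K_t$ is robustly critical for all integers $t\ge n^3$. -/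

import Mathlib

universe u v w

namespace SimpleGraph

/-- The join of two graphs: disjoint copies of `G` and `H` together with all edges between
the two copies. -/
def join {V : Type u} {W : Type v} (G : SimpleGraph V) (H : SimpleGraph W) :
    SimpleGraph (V ⊕ W) :=
  (G ⊕g H) ⊔ completeBipartiteGraph V W

/-- `G` is `k`-critical: its chromatic number is `k`, and every proper subgraph (obtained by
deleting vertices and/or edges) has chromatic number less than `k`. -/
def IsCritical {V : Type u} (G : SimpleGraph V) (k : ℕ) : Prop :=
  G.chromaticNumber = (k : ℕ∞) ∧
    ∀ G' : G.Subgraph, G' ≠ ⊤ → G'.coe.chromaticNumber < (k : ℕ∞)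

/-- A cover `(L, H)` of a graph `G`, where the graph `H` has vertex set `W` (the set of colors). -/
structure DPCover {V : Type u} (G : SimpleGraph V) (W : Type w) where
  /-- The graph on the set of colors. -/
  H : SimpleGraph W
  /-- The list of colors of each vertex. -/
  L : V → Set W
  /-- The lists are pairwise disjoint. -/
  disjoint : ∀ x y : V, x ≠ y → Disjoint (L x) (L y)
  /-- The lists are independent sets in `H`. -/
  indep : ∀ x : V, H.IsIndepSet (L x)
  /-- Every color lies in some list. -/
  cover : ⋃ x : V, L x = Set.univ
  /-- Edges of `H` only join lists of adjacent vertices. -/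
  adj_of_adj : ∀ x y : V, ∀ c ∈ L x, ∀ d ∈ L y, H.Adj c d → G.Adj x y
  /-- The edges of `H` between two lists form a matching: a color in `L x` has at most one
  neighbor in `L y` (for every ordered pair `(x, y)`). -/
  matching : ∀ x y : V, ∀ c ∈ L x, ∀ d ∈ L y, ∀ d' ∈ L y, H.Adj c d → H.Adj c d' → d = d'

namespace DPCover

variable {V : Type u} {G : SimpleGraph V} {W : Type w}

/-- `T` is an independent transversal of the cover, i.e. a proper coloring of `G` with respect
to the cover. -/
def IsIndepTransversal (𝓗 : DPCover G W) (T : Set W) : Prop :=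
  𝓗.H.IsIndepSet T ∧ ∀ x : V, ∃! c : W, c ∈ T ∧ c ∈ 𝓗.L x

/-- `G` is colorable with respect to the cover. -/
def IsColorable (𝓗 : DPCover G W) : Prop :=
  ∃ T : Set W, 𝓗.IsIndepTransversal T

/-- The cover is bad if `G` is not colorable with respect to it. -/
def IsBad (𝓗 : DPCover G W) : Prop :=
  ¬ 𝓗.IsColorable

/-- The cover is `k`-fold: every list consists of exactly `k` colors. -/
def IsFold (𝓗 : DPCover G W) (k : ℕ) : Prop :=
  ∀ x : V, (𝓗.L x).encard = (k : ℕ∞)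

/-- `lam` is a canonical labeling, with labels in a `k`-element set. -/
def IsCanonicalLabeling (𝓗 : DPCover G W) (k : ℕ) (lam : W → Fin k) : Prop :=
  (∀ x : V, Set.BijOn lam (𝓗.L x) Set.univ) ∧
    ∀ x y : V, G.Adj x y → ∀ c ∈ 𝓗.L x, ∀ d ∈ 𝓗.L y, (𝓗.H.Adj c d ↔ lam c = lam d)

/-- The cover is a canonical `k`-fold cover. -/
def IsCanonical (𝓗 : DPCover G W) (k : ℕ) : Prop :=
  𝓗.IsFold k ∧ ∃ lam : W → Fin k, 𝓗.IsCanonicalLabeling k lam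

end DPCover

/-- `G` is colorable with respect to every `k`-fold cover. For a finite graph, `k`-fold covers have
finitely many colors, so the choice of the universe `w` of the color sets does not matter. -/
def IsDPColorable {V : Type u} (G : SimpleGraph V) (k : ℕ) : Prop :=
  ∀ (W : Type w) (𝓗 : DPCover G W), 𝓗.IsFold k → 𝓗.IsColorable

/-- The DP-chromatic number: the least `k` such that `G` is colorable with respect to every
`k`-fold cover (and `⊤` if there is no such `k`). -/
noncomputable def dpChromaticNumber {V : Type u} (G : SimpleGraph V) : ℕ∞ :=
  ⨅ k ∈ {k : ℕ | IsDPColorable.{u, w} G k}, (k : ℕ∞)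

/-- `G` is robustly `k`-critical: `k ≥ 1`, `G` is `k`-critical, and every bad `(k - 1)`-fold cover
of `G` is canonical. -/
def IsRobustlyKCritical {V : Type u} (G : SimpleGraph V) (k : ℕ) : Prop :=
  1 ≤ k ∧ G.IsCritical k ∧
    ∀ (W : Type w) (𝓗 : DPCover G W), 𝓗.IsFold (k - 1) → 𝓗.IsBad → 𝓗.IsCanonical (k - 1)

/-- `G` is robustly critical if it is robustly `k`-critical for some `k`. -/
def IsRobustlyCritical {V : Type u} (G : SimpleGraph V) : Prop :=
  ∃ k : ℕ, IsRobustlyKCritical.{u, w} G k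

end SimpleGraph

/-! Let m = k + t - 1 and suppose an m-fold cover of the join is bad. Color part of the clique, say
a set D. Each colored clique vertex removes at most one color from the list of a vertex v of G; the
surplus of v, |free(v)| + |D| - m, counts the removals saved. If every surplus is positive, coloring
the rest of the clique greedily leaves k free colors at each vertex of G, and χ_DP(G) = k finishes
the coloring (`isColorable_of_surplus_pos`). So in a bad cover some vertex u always has surplus 0.

Choose D to maximize the total surplus, truncated at n per vertex, subject to |D| being at most
twice that total (`IsSaturated`). Coloring one or two further clique vertices then gains nothing at
a vertex of surplus below n. This rigidity lets the free colors of u serve as labels for the free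
colors of the uncolored clique vertices and, through them, of the low-surplus vertices of G
(`exists_isAligned`).

Criticality supplies (k - 1)-colorings of G minus a vertex or minus an edge. Their classes receive
distinct labels that avoid the remaining conflicts, and the uncolored clique vertices use up the
other labels. Each possible defect would allow such a coloring to be completed: a vertex of surplus
at least n (`isColorable_of_surplus`), an edge of G not matching equal labels
(`adj_of_not_isColorable`), or an unlabeled free color (`free_eq_range`). Without defects every
surplus is 0, which forces D = ∅, and the labels make the whole cover canonical. -/

namespace SimpleGraph

namespace DPCover

/-! ### Partial colorings of a cover and greedy extension. -/

section Partial

variable {X : Type u} {J : SimpleGraph X} {W : Type w} (𝓗 : DPCover J W)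

/-- `g` is a proper coloring of the vertices in `D` with respect to the cover. -/
def IsPartialColoring (D : Finset X) (g : X → W) : Prop :=
  (∀ x ∈ D, g x ∈ 𝓗.L x) ∧ ∀ x ∈ D, ∀ y ∈ D, ¬ 𝓗.H.Adj (g x) (g y)

/-- The colors of `x` that have no neighbor among the colors chosen on `D`. -/
def free (D : Finset X) (g : X → W) (x : X) : Set W :=
  {c | c ∈ 𝓗.L x ∧ ∀ d ∈ D, ¬ 𝓗.H.Adj c (g d)}

variable {𝓗}

theorem eq_of_mem_of_mem {x y : X} {c : W} (hx : c ∈ 𝓗.L x) (hy : c ∈ 𝓗.L y) : x = y := by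
  by_contra h
  exact Set.disjoint_left.1 (𝓗.disjoint x y h) hx hy

theorem not_adj_of_not_adj {x y : X} {c d : W} (hx : c ∈ 𝓗.L x) (hy : d ∈ 𝓗.L y)
    (h : ¬ J.Adj x y) : ¬ 𝓗.H.Adj c d :=
  fun h' => h (𝓗.adj_of_adj x y c hx d hy h')

theorem free_empty (g : X → W) (x : X) : 𝓗.free ∅ g x = 𝓗.L x := by
  simp [free]

theorem free_congr {D : Finset X} {g g' : X → W} (h : ∀ d ∈ D, g d = g' d) (x : X) :
    𝓗.free D g x = 𝓗.free D g' x := by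
  ext c
  simp only [free, Set.mem_ofPred_eq]
  refine and_congr_right fun _ => forall₂_congr fun d hd => ?_
  rw [h d hd]

theorem IsPartialColoring.isColorable [Fintype X] {g : X → W}
    (h : 𝓗.IsPartialColoring Finset.univ g) : 𝓗.IsColorable := by
  refine ⟨Set.range g, ?_, fun x => ⟨g x, ⟨⟨x, rfl⟩, h.1 x (Finset.mem_univ x)⟩, ?_⟩⟩
  · rintro _ ⟨x, rfl⟩ _ ⟨y, rfl⟩ _
    exact h.2 x (Finset.mem_univ x) y (Finset.mem_univ y)
  · rintro _ ⟨⟨y, rfl⟩, hy⟩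
    rw [eq_of_mem_of_mem hy (h.1 y (Finset.mem_univ y))]

theorem IsPartialColoring.congr {D : Finset X} {g g' : X → W} (h : 𝓗.IsPartialColoring D g)
    (hg : ∀ d ∈ D, g d = g' d) : 𝓗.IsPartialColoring D g' := by
  refine ⟨fun x hx => hg x hx ▸ h.1 x hx, fun x hx y hy => ?_⟩
  rw [← hg x hx, ← hg y hy]
  exact h.2 x hx y hy

theorem IsPartialColoring.insert [DecidableEq X] {D : Finset X} {g : X → W}
    (h : 𝓗.IsPartialColoring D g) {x : X} (hx : g x ∈ 𝓗.free D g x) :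
    𝓗.IsPartialColoring (insert x D) g := by
  refine ⟨fun y hy => ?_, fun y hy z hz => ?_⟩
  · rcases Finset.mem_insert.1 hy with rfl | hy
    exacts [hx.1, h.1 y hy]
  · rcases Finset.mem_insert.1 hy with hyx | hy <;> rcases Finset.mem_insert.1 hz with hzx | hz
    · rw [hyx, hzx]
      exact 𝓗.H.loopless.irrefl _
    · rw [hyx]
      exact hx.2 z hz
    · rw [hzx]
      exact fun h' => hx.2 y hy h'.symm
    · exact h.2 y hy z hz

/-- Extend a partial coloring to one more vertex by a free color. -/
theorem IsPartialColoring.insert_update [DecidableEq X] {D : Finset X} {g : X → W}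
    (h : 𝓗.IsPartialColoring D g) {x : X} (hxD : x ∉ D) {c : W} (hc : c ∈ 𝓗.free D g x) :
    𝓗.IsPartialColoring (Insert.insert x D) (Function.update g x c) := by
  have hg : ∀ d ∈ D, g d = Function.update g x c d := fun d hd => by
    rw [Function.update_of_ne (ne_of_mem_of_not_mem hd hxD)]
  refine (h.congr hg).insert ?_
  rw [← free_congr hg, Function.update_self]
  exact hc

theorem free_insert [DecidableEq X] (D : Finset X) (g : X → W) (x y : X) :
    𝓗.free (insert y D) g x = 𝓗.free D g x \ {c | 𝓗.H.Adj c (g y)} := by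
  ext c
  simp only [free, Finset.mem_insert, forall_eq_or_imp, Set.mem_ofPred_eq, Set.mem_sdiff]
  tauto

theorem free_diff_subsingleton (x y : X) {d : W} (hd : d ∈ 𝓗.L y) :
    (𝓗.L x ∩ {c | 𝓗.H.Adj c d}).Subsingleton :=
  fun c hc c' hc' => 𝓗.matching y x d hd c hc.1 c' hc'.1 hc.2.symm hc'.2.symm

theorem ncard_free_le_insert [Finite W] [DecidableEq X] {D : Finset X} {g : X → W} (x : X)
    {y : X} (hy : g y ∈ 𝓗.L y) :
    (𝓗.free D g x).ncard ≤ (𝓗.free (insert y D) g x).ncard + 1 := by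
  rw [free_insert]
  have h1 : (𝓗.L x ∩ {c | 𝓗.H.Adj c (g y)}).ncard ≤ 1 :=
    Set.ncard_le_one_iff_subsingleton.2 (free_diff_subsingleton x y hy)
  have h2 : 𝓗.free D g x ⊆
      (𝓗.free D g x \ {c | 𝓗.H.Adj c (g y)}) ∪ (𝓗.L x ∩ {c | 𝓗.H.Adj c (g y)}) := by
    intro c hc
    by_cases h : 𝓗.H.Adj c (g y)
    exacts [Or.inr ⟨hc.1, h⟩, Or.inl ⟨hc, h⟩]
  have h3 := Set.ncard_le_ncard h2 (Set.toFinite _)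
  have h4 := Set.ncard_union_le (𝓗.free D g x \ {c | 𝓗.H.Adj c (g y)})
    (𝓗.L x ∩ {c | 𝓗.H.Adj c (g y)})
  omega

theorem ncard_free_le_union [Finite W] [DecidableEq X] {D E : Finset X} {g : X → W} (x : X)
    (hE : ∀ y ∈ E, g y ∈ 𝓗.L y) :
    (𝓗.free D g x).ncard ≤ (𝓗.free (D ∪ E) g x).ncard + E.card := by
  induction E using Finset.induction_on with
  | empty => simp
  | insert y E hy ih =>
    have h1 := ih fun z hz => hE z (Finset.mem_insert_of_mem hz)
    have h2 := ncard_free_le_insert (D := D ∪ E) x (hE y (Finset.mem_insert_self y E))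
    rw [Finset.union_insert, Finset.card_insert_of_notMem hy]
    omega

/-- Coloring one vertex of `E` costs each other vertex at most one free color, while the number of
vertices still to be colored also drops by one. -/
theorem IsPartialColoring.exists_greedy [Finite W] [DecidableEq X] {D : Finset X} {g : X → W}
    (h : 𝓗.IsPartialColoring D g) (E : Finset X) (hDE : Disjoint D E)
    (hE : ∀ x ∈ E, E.card ≤ (𝓗.free D g x).ncard) :
    ∃ g' : X → W, (∀ d ∈ D, g d = g' d) ∧ 𝓗.IsPartialColoring (D ∪ E) g' := by
  induction E using Finset.induction_on generalizing D g with
  | empty => exact ⟨g, fun _ _ => rfl, by simpa using h⟩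
  | insert y E hy ih =>
    rw [Finset.card_insert_of_notMem hy] at hE
    have hyD : y ∉ D := Finset.disjoint_right.1 hDE (Finset.mem_insert_self y E)
    obtain ⟨c, hc⟩ : (𝓗.free D g y).Nonempty := by
      rw [← Set.ncard_pos]
      have := hE y (Finset.mem_insert_self y E)
      omega
    have hg : ∀ d ∈ D, g d = Function.update g y c d := fun d hd => by
      rw [Function.update_of_ne (ne_of_mem_of_not_mem hd hyD)]
    have h1 := h.insert_update hyD hc
    obtain ⟨g', hg', hp⟩ := ih h1 (Finset.disjoint_insert_left.2
        ⟨hy, hDE.mono_right (Finset.subset_insert y E)⟩) fun x hx => by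
      have h2 := ncard_free_le_insert (D := D) x (h1.1 y (Finset.mem_insert_self y D))
      rw [← free_congr hg] at h2
      have := hE x (Finset.mem_insert_of_mem hx)
      omega
    refine ⟨g', fun d hd => (hg d hd).trans (hg' d (Finset.mem_insert_of_mem hd)), ?_⟩
    rwa [Finset.insert_union, ← Finset.union_insert] at hp

theorem ncard_list_le [Finite W] [DecidableEq X] {D : Finset X} {g : X → W}
    (h : 𝓗.IsPartialColoring D g) (x : X) :
    (𝓗.L x).ncard ≤ (𝓗.free D g x).ncard + D.card := by
  have := ncard_free_le_union (D := ∅) (E := D) (g := g) x h.1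
  rwa [Finset.empty_union, free_empty] at this

/-- This monotonicity is why surpluses never decrease as a partial coloring grows. -/
theorem ncard_free_add_card_le [Finite W] [DecidableEq X] {D D' : Finset X} {g g' : X → W}
    (h' : 𝓗.IsPartialColoring D' g') (hD : D ⊆ D') (hg : ∀ d ∈ D, g d = g' d) (x : X) :
    (𝓗.free D g x).ncard + D.card ≤ (𝓗.free D' g' x).ncard + D'.card := by
  have := ncard_free_le_union (D := D) (E := D' \ D) (g := g') x
    fun y hy => h'.1 y (Finset.mem_sdiff.1 hy).1
  rw [Finset.union_sdiff_of_subset hD, ← free_congr hg] at this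
  have := Finset.card_sdiff_add_card_eq_card hD
  omega

theorem IsFold.ncard_eq {k : ℕ} (h : 𝓗.IsFold k) (x : X) : (𝓗.L x).ncard = k := by
  rw [Set.ncard, h x, ENat.toNat_natCast]

theorem IsFold.finite [Finite X] {k : ℕ} (h : 𝓗.IsFold k) : Finite W := by
  rw [← Set.finite_univ_iff, ← 𝓗.cover]
  exact Set.finite_iUnion fun x => Set.finite_of_encard_eq_coe (h x)

end Partial

end DPCover

/-! ### Conflict-free labels for color classes. -/

/-- Greedy choice of distinct labels for color classes that avoids a given matching-type conflict
relation between vertices of different classes. -/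
theorem exists_injective_labeling {V ι : Type*} {Λ : Type*} [Fintype V] [DecidableEq V]
    [Fintype ι] [DecidableEq ι] [Fintype Λ] [DecidableEq Λ]
    (C : V → Λ → V → Λ → Prop) (hC : ∀ x a y b b', C x a y b → C x a y b' → b = b')
    (hsymm : ∀ x a y b, C x a y b → C y b x a) (f : V → ι) (i₀ : ι) (a₀ : Λ) (F : Finset Λ)
    (hcard : Fintype.card ι + Fintype.card V * (Fintype.card V - 1) + F.card ≤ Fintype.card Λ) :
    ∃ φ : ι → Λ, φ.Injective ∧ φ i₀ = a₀ ∧ (∀ i, i ≠ i₀ → φ i ∉ F) ∧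
      ∀ x y, f x ≠ f y → ¬ C x (φ (f x)) y (φ (f y)) := by
  classical
  suffices H : ∀ s : Finset ι, i₀ ∉ s → ∃ φ : ι → Λ, Set.InjOn φ (insert i₀ s : Finset ι) ∧
      φ i₀ = a₀ ∧ (∀ i ∈ s, φ i ∉ F) ∧ ∀ x y, f x ∈ insert i₀ s → f y ∈ insert i₀ s →
        f x ≠ f y → ¬ C x (φ (f x)) y (φ (f y)) by
    obtain ⟨φ, h1, h2, h3, h4⟩ := H (Finset.univ.erase i₀) (Finset.notMem_erase _ _)
    rw [Finset.insert_erase (Finset.mem_univ i₀)] at h1 h4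
    exact ⟨φ, by simpa using h1, h2, fun i hi => h3 i (by simpa using hi),
      fun x y => h4 x y (Finset.mem_univ _) (Finset.mem_univ _)⟩
  intro s
  induction s using Finset.induction_on with
  | empty =>
    intro _
    refine ⟨fun _ => a₀, by simp, rfl, by simp, fun x y hx hy hxy => ?_⟩
    simp only [insert_empty_eq, Finset.mem_singleton] at hx hy
    exact absurd (hx.trans hy.symm) hxy
  | insert i s hi ih =>
    intro hi₀
    rw [Finset.mem_insert, not_or] at hi₀
    obtain ⟨φ, h1, h2, h3, h4⟩ := ih hi₀.2
    have hi' : i ∉ insert i₀ s := by simp [hi, Ne.symm hi₀.1]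
    -- The labels forbidden for class `i`: those already used, those in `F`, and at most one for
    -- each ordered pair of distinct vertices. Pairs whose first vertex lies in an unlabeled class
    -- only forbid more than necessary.
    let B : Finset Λ := (insert i₀ s).image φ ∪ F ∪
      (Finset.univ : Finset V).offDiag.biUnion
        fun p => Finset.univ.filter fun b => C p.1 (φ (f p.1)) p.2 b
    have hB : B.card < Fintype.card Λ := by
      have e1 : ((insert i₀ s).image φ).card < Fintype.card ι :=
        Finset.card_image_le.trans_lt (Finset.card_lt_univ_of_notMem hi')
      have e2 : ((Finset.univ : Finset V).offDiag.biUnion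
          fun p => Finset.univ.filter fun b => C p.1 (φ (f p.1)) p.2 b).card ≤
          Fintype.card V * (Fintype.card V - 1) := by
        refine (Finset.card_biUnion_le_card_mul _ _ 1 fun p _ => ?_).trans ?_
        · rw [Finset.card_le_one]
          intro b hb b' hb'
          exact hC _ _ _ _ _ (Finset.mem_filter.1 hb).2 (Finset.mem_filter.1 hb').2
        · rw [mul_one, Finset.offDiag_card, Finset.card_univ, Nat.mul_sub_one]
      have e3 : B.card ≤ _ := Finset.card_union_le _ _
      have e4 := Finset.card_union_le ((insert i₀ s).image φ) F
      omega
    obtain ⟨b, -, hb⟩ := Finset.exists_mem_notMem_of_card_lt_card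
      (hB.trans_eq Finset.card_univ.symm)
    simp only [B, Finset.mem_union, not_or, Finset.mem_biUnion, Finset.mem_filter,
      Finset.mem_univ, true_and, not_exists, not_and, Finset.mem_offDiag, Prod.forall] at hb
    obtain ⟨⟨hb1, hb2⟩, hb3⟩ := hb
    have hne : ∀ j ∈ insert i₀ s, Function.update φ i b j = φ j := fun j hj =>
      Function.update_of_ne (ne_of_mem_of_not_mem hj hi') _ _
    have hmem : ∀ j, j ∈ insert i₀ (insert i s) ↔ j = i ∨ j ∈ insert i₀ s := by
      intro j; simp only [Finset.mem_insert]; tauto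
    refine ⟨Function.update φ i b, ?_, ?_, ?_, ?_⟩
    · intro j hj j' hj' hjj
      rw [Finset.mem_coe, hmem] at hj hj'
      rcases hj with rfl | hj <;> rcases hj' with rfl | hj'
      · rfl
      · rw [Function.update_self, hne _ hj'] at hjj
        exact absurd (Finset.mem_image.2 ⟨_, hj', hjj.symm⟩) hb1
      · rw [Function.update_self, hne _ hj] at hjj
        exact absurd (Finset.mem_image.2 ⟨_, hj, hjj⟩) hb1
      · rw [hne _ hj, hne _ hj'] at hjj
        exact h1 hj hj' hjj
    · rw [hne _ (Finset.mem_insert_self _ _), h2]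
    · intro j hj
      rcases Finset.mem_insert.1 hj with rfl | hj
      · rwa [Function.update_self]
      · rw [hne _ (Finset.mem_insert_of_mem hj)]
        exact h3 j hj
    · intro x y hx hy hxy
      have hxy' : x ≠ y := fun h => hxy (h ▸ rfl)
      rw [hmem] at hx hy
      rcases hx with hx | hx <;> rcases hy with hy | hy
      · exact absurd (hx.trans hy.symm) hxy
      · rw [hx, Function.update_self, hne _ hy]
        exact fun h => hb3 y x hxy'.symm (hsymm _ _ _ _ h)
      · rw [hy, Function.update_self, hne _ hx]
        exact hb3 x y hxy'
      · rw [hne _ hx, hne _ hy]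
        exact h4 x y hx hy hxy

/-! ### Adjacency in the join. -/

section Join

variable {V : Type u} {Y : Type v} {G : SimpleGraph V} {K : SimpleGraph Y}

@[simp]
theorem join_adj_inl_inl {x y : V} : (G.join K).Adj (.inl x) (.inl y) ↔ G.Adj x y := by
  simp [join]

@[simp]
theorem join_adj_inr_inr {x y : Y} : (G.join K).Adj (.inr x) (.inr y) ↔ K.Adj x y := by
  simp [join]

@[simp]
theorem join_adj_inl_inr {x : V} {y : Y} : (G.join K).Adj (.inl x) (.inr y) := by
  simp [join]

@[simp]
theorem join_adj_inr_inl {x : V} {y : Y} : (G.join K).Adj (.inr y) (.inl x) := by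
  simp [join]

end Join

/-! ### Surplus and saturated partial colorings of the clique. -/

namespace DPCover

variable {V : Type u} {Y : Type v} {G : SimpleGraph V}
  {W : Type w} (𝓗 : DPCover (G.join (completeGraph Y)) W)

/-- The number of free colors of the vertex `v` in excess of the trivial lower bound for an
`m`-fold cover. -/
noncomputable def surplus (m : ℕ) (D : Finset (V ⊕ Y)) (g : V ⊕ Y → W) (v : V) : ℕ :=
  (𝓗.free D g (.inl v)).ncard + D.card - m

variable {𝓗} in
theorem surplus_mono [Finite W] [DecidableEq V] [DecidableEq Y] (m : ℕ) {D D' : Finset (V ⊕ Y)}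
    {g g' : V ⊕ Y → W} (h' : 𝓗.IsPartialColoring D' g') (hD : D ⊆ D') (hg : ∀ d ∈ D, g d = g' d)
    (v : V) : 𝓗.surplus m D g v ≤ 𝓗.surplus m D' g' v :=
  Nat.sub_le_sub_right (ncard_free_add_card_le h' hD hg _) _

variable [Fintype V]

/-- The total surplus, truncated at the number of vertices. -/
noncomputable def totalSurplus (m : ℕ) (D : Finset (V ⊕ Y)) (g : V ⊕ Y → W) : ℕ :=
  ∑ v, min (𝓗.surplus m D g v) (Fintype.card V)

variable {𝓗}

theorem totalSurplus_le (m : ℕ) (D : Finset (V ⊕ Y)) (g : V ⊕ Y → W) :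
    𝓗.totalSurplus m D g ≤ Fintype.card V * Fintype.card V := by
  refine (Finset.sum_le_card_nsmul _ _ (Fintype.card V) fun v _ => min_le_right _ _).trans ?_
  simp

/-- Saving the contribution of `u`, compared with the bound n², is what keeps |D| small enough for t
≥ n³. -/
theorem totalSurplus_le_of_surplus_eq_zero {m : ℕ} {D : Finset (V ⊕ Y)} {g : V ⊕ Y → W} {u : V}
    (hu : 𝓗.surplus m D g u = 0) :
    𝓗.totalSurplus m D g ≤ (Fintype.card V - 1) * Fintype.card V := by
  classical
  rw [totalSurplus, ← Finset.add_sum_erase _ _ (Finset.mem_univ u), hu, Nat.zero_min, zero_add]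
  refine (Finset.sum_le_card_nsmul _ _ (Fintype.card V) fun v _ => min_le_right _ _).trans ?_
  simp [Finset.card_erase_of_mem]

variable (𝓗) in
/-- A partial coloring of the clique whose surplus cannot be increased by coloring at most two
further vertices. -/
structure IsSaturated (m : ℕ) (D : Finset (V ⊕ Y)) (g : V ⊕ Y → W) : Prop where
  isPartialColoring : 𝓗.IsPartialColoring D g
  isRight : ∀ x ∈ D, x.isRight
  card_le : D.card ≤ 2 * 𝓗.totalSurplus m D g
  surplus_le : ∀ (D' : Finset (V ⊕ Y)) (g' : V ⊕ Y → W), 𝓗.IsPartialColoring D' g' →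
    (∀ x ∈ D', x.isRight) → D ⊆ D' → (∀ d ∈ D, g d = g' d) → D'.card ≤ D.card + 2 →
    ∀ v, 𝓗.surplus m D g v < Fintype.card V → 𝓗.surplus m D' g' v ≤ 𝓗.surplus m D g v

/-- Maximize the total surplus. An extension by at most two vertices that raises some surplus below
n raises the total by at least one, so it still satisfies the size bound and would contradict
maximality. -/
theorem exists_isSaturated [Finite W] [Nonempty W] [DecidableEq V] [DecidableEq Y] (m : ℕ) :
    ∃ D g, 𝓗.IsSaturated m D g := by
  let S : Set ℕ := {s | ∃ D g, 𝓗.IsPartialColoring D g ∧ (∀ x ∈ D, x.isRight) ∧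
    D.card ≤ 2 * 𝓗.totalSurplus m D g ∧ 𝓗.totalSurplus m D g = s}
  have hne : S.Nonempty :=
    ⟨_, ∅, fun _ => Classical.arbitrary W, ⟨by simp, by simp⟩, by simp, by simp, rfl⟩
  have hbdd : BddAbove S := by
    refine ⟨Fintype.card V * Fintype.card V, ?_⟩
    rintro _ ⟨D, g, -, -, -, rfl⟩
    exact totalSurplus_le m D g
  obtain ⟨D, g, h1, h2, h3, h4⟩ := Nat.sSup_mem hne hbdd
  refine ⟨D, g, h1, h2, h3, fun D' g' h1' h2' hD hg hc v hv => ?_⟩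
  by_contra! hlt
  have hsum : 𝓗.totalSurplus m D g < 𝓗.totalSurplus m D' g' := by
    refine Finset.sum_lt_sum (fun x _ => ?_) ⟨v, Finset.mem_univ v, ?_⟩
    · exact min_le_min_right _ (surplus_mono m h1' hD hg x)
    · rw [min_eq_left hv.le]
      exact lt_min hlt hv
  have := le_csSup hbdd (show 𝓗.totalSurplus m D' g' ∈ S from ⟨D', g', h1', h2', by omega, rfl⟩)
  omega

/-- Otherwise coloring `a` with `α` removes no free color of `v`, so the surplus of `v` grows by
one. -/
theorem IsSaturated.exists_adj [Finite W] [DecidableEq V] [DecidableEq Y] {m : ℕ}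
    {D : Finset (V ⊕ Y)} {g : V ⊕ Y → W} (h : 𝓗.IsSaturated m D g) (hm : 𝓗.IsFold m) {v : V}
    (hv : 𝓗.surplus m D g v < Fintype.card V) {a : Y} (ha : .inr a ∉ D) {α : W}
    (hα : α ∈ 𝓗.free D g (.inr a)) : ∃ γ ∈ 𝓗.free D g (.inl v), 𝓗.H.Adj α γ := by
  by_contra! hno
  have hg : ∀ d ∈ D, g d = Function.update g (.inr a) α d := fun d hd => by
    rw [Function.update_of_ne (ne_of_mem_of_not_mem hd ha)]
  have hcard := Finset.card_insert_of_notMem ha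
  have key := h.surplus_le _ _ (h.isPartialColoring.insert_update ha hα)
    (by simpa using h.isRight) (Finset.subset_insert _ _) hg (by omega) v hv
  have hfree : 𝓗.free (insert (.inr a) D) (Function.update g (.inr a) α) (.inl v) =
      𝓗.free D g (.inl v) := by
    rw [free_insert, ← free_congr hg, Function.update_self]
    ext c
    simp only [Set.mem_sdiff, Set.mem_ofPred_eq, and_iff_left_iff_imp]
    exact fun hc h' => hno c hc h'.symm
  have := ncard_list_le h.isPartialColoring (.inl v)
  rw [hm.ncard_eq] at this
  simp only [surplus, hfree, hcard] at key
  omega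

/-- Otherwise `a` and `b` can both be colored, by `α` and `β`, and together they remove only `γ`
from the free colors of `v`: two vertices colored at the price of one color. -/
theorem IsSaturated.adj [Finite W] [DecidableEq V] [DecidableEq Y] {m : ℕ}
    {D : Finset (V ⊕ Y)} {g : V ⊕ Y → W} (h : 𝓗.IsSaturated m D g) (hm : 𝓗.IsFold m) {v : V}
    (hv : 𝓗.surplus m D g v < Fintype.card V) {a b : Y} (hab : a ≠ b) (ha : .inr a ∉ D)
    (hb : .inr b ∉ D) {α β γ : W} (hα : α ∈ 𝓗.free D g (.inr a))
    (hβ : β ∈ 𝓗.free D g (.inr b)) (hγ : γ ∈ 𝓗.free D g (.inl v)) (hγα : 𝓗.H.Adj γ α)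
    (hγβ : 𝓗.H.Adj γ β) : 𝓗.H.Adj α β := by
  by_contra hno
  have hg : ∀ d ∈ D, g d = Function.update g (.inr a) α d := fun d hd => by
    rw [Function.update_of_ne (ne_of_mem_of_not_mem hd ha)]
  have hcard := Finset.card_insert_of_notMem ha
  have hp := h.isPartialColoring.insert_update ha hα
  have hb' : (.inr b : V ⊕ Y) ∉ insert (.inr a) D := by
    simp [hb, hab.symm]
  have hβ' : β ∈ 𝓗.free (insert (.inr a) D) (Function.update g (.inr a) α) (.inr b) := by
    rw [free_insert, ← free_congr hg, Function.update_self]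
    exact ⟨hβ, fun h' => hno h'.symm⟩
  set g₁ := Function.update g (.inr a) α with hg₁
  have hgb : ∀ d ∈ (insert (.inr a) D : Finset (V ⊕ Y)), g₁ d = Function.update g₁ (.inr b) β d :=
    fun d hd => by rw [Function.update_of_ne (ne_of_mem_of_not_mem hd hb')]
  have hcard' := Finset.card_insert_of_notMem hb'
  have key := h.surplus_le _ _ (hp.insert_update hb' hβ')
    (by simpa using h.isRight)
    ((Finset.subset_insert _ _).trans (Finset.subset_insert _ _))
    (fun d hd => (hg d hd).trans (hgb d (Finset.mem_insert_of_mem hd))) (by omega) v hv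
  have hα' : g₁ (.inr a) = α := by rw [hg₁, Function.update_self]
  have hfree : 𝓗.free D g (.inl v) ⊆ insert γ (𝓗.free (insert (.inr b) (insert (.inr a) D))
      (Function.update g₁ (.inr b) β) (.inl v)) := by
    intro c hc
    by_cases hcγ : c = γ
    · exact Or.inl hcγ
    refine Or.inr ?_
    rw [free_insert, ← free_congr hgb, Function.update_self, free_insert, ← free_congr hg, hα']
    refine ⟨⟨hc, fun h' => hcγ ?_⟩, fun h' => hcγ ?_⟩
    · exact free_diff_subsingleton (.inl v) (.inr a) hα.1 ⟨hc.1, h'⟩ ⟨hγ.1, hγα⟩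
    · exact free_diff_subsingleton (.inl v) (.inr b) hβ.1 ⟨hc.1, h'⟩ ⟨hγ.1, hγβ⟩
  have h1 := (Set.ncard_le_ncard hfree (Set.toFinite _)).trans (Set.ncard_insert_le _ _)
  have := ncard_list_le h.isPartialColoring (.inl v)
  rw [hm.ncard_eq] at this
  simp only [surplus, hcard', hcard] at key
  omega

variable (𝓗) in
/-- Labelings of the free colors of the uncolored clique vertices and of the vertices in `U` such
that adjacent colors receive equal labels, provided that one of them belongs to the clique. -/
structure IsAligned (D : Finset (V ⊕ Y)) (g : V ⊕ Y → W) (U : Set V) {Λ : Type w}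
    (τ : Y → Λ → W) (σ : V → Λ → W) : Prop where
  isPartialColoring : 𝓗.IsPartialColoring D g
  isRight : ∀ x ∈ D, x.isRight
  τ_mem : ∀ b, .inr b ∉ D → ∀ ℓ, τ b ℓ ∈ 𝓗.free D g (.inr b)
  τ_inj : ∀ b, .inr b ∉ D → (τ b).Injective
  τ_adj : ∀ b b', .inr b ∉ D → .inr b' ∉ D → b ≠ b' → ∀ ℓ ℓ',
    𝓗.H.Adj (τ b ℓ) (τ b' ℓ') ↔ ℓ = ℓ'
  σ_mem : ∀ v ∈ U, ∀ ℓ, σ v ℓ ∈ 𝓗.free D g (.inl v)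
  σ_inj : ∀ v ∈ U, (σ v).Injective
  eq_of_adj : ∀ v ∈ U, ∀ b, .inr b ∉ D → ∀ ℓ ℓ', 𝓗.H.Adj (σ v ℓ) (τ b ℓ') → ℓ = ℓ'

/-- The labels are the free colors of `u`. The color `τ b ℓ` is the neighbor of `ℓ` at `b`, and `σ v
ℓ` is a neighbor of `τ a₀ ℓ` at `v`. That labels agree across different clique vertices follows from
`IsSaturated.adj`. -/
theorem IsSaturated.exists_isAligned [Finite W] [DecidableEq V] [DecidableEq Y] {m : ℕ}
    {D : Finset (V ⊕ Y)} {g : V ⊕ Y → W} (h : 𝓗.IsSaturated m D g) (hm : 𝓗.IsFold m)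
    {u : V} (hu : 𝓗.surplus m D g u = 0) {a₀ : Y} (ha₀ : .inr a₀ ∉ D) :
    ∃ (Λ : Type w) (_ : Fintype Λ) (τ : Y → Λ → W) (σ : V → Λ → W), Fintype.card Λ + D.card = m ∧
      𝓗.IsAligned D g {v | 𝓗.surplus m D g v < Fintype.card V} τ σ := by
  classical
  have hpos : 0 < Fintype.card V := Fintype.card_pos_iff.2 ⟨u⟩
  have hu' : 𝓗.surplus m D g u < Fintype.card V := by omega
  let Λ : Type w := 𝓗.free D g (.inl u)
  have hΛ : Nat.card Λ + D.card = m := by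
    have := ncard_list_le h.isPartialColoring (.inl u)
    rw [hm.ncard_eq] at this
    rw [Nat.card_coe_set_eq]
    simp only [surplus] at hu
    omega
  have hτ : ∀ b : Y, ∃ τ : Λ → W, .inr b ∉ D →
      ∀ ℓ, τ ℓ ∈ 𝓗.free D g (.inr b) ∧ 𝓗.H.Adj (τ ℓ) ℓ := by
    intro b
    by_cases hb : (.inr b : V ⊕ Y) ∈ D
    · exact ⟨fun ℓ => ℓ, fun h' => absurd hb h'⟩
    choose! ν hν hνadj using fun α (hα : α ∈ 𝓗.free D g (.inr b)) => h.exists_adj hm hu' hb hα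
    let F : 𝓗.free D g (.inr b) → Λ := fun α => ⟨ν α, hν α α.2⟩
    have hinj : F.Injective := by
      intro α β hαβ
      have e : ν α = ν β := congrArg Subtype.val hαβ
      exact Subtype.ext (𝓗.matching (.inl u) (.inr b) (ν α) (hν α α.2).1 α α.2.1 β β.2.1
        (hνadj α α.2).symm (e ▸ (hνadj β β.2).symm))
    -- Surplus 0 means that `u` has exactly m - |D| free colors, the least possible number, so the
    -- injection `F` must be a bijection.
    have hcard : Nat.card Λ ≤ Nat.card (𝓗.free D g (.inr b)) := by
      have := ncard_list_le h.isPartialColoring (.inr b)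
      rw [hm.ncard_eq] at this
      rw [Nat.card_coe_set_eq (𝓗.free D g (.inr b))]
      omega
    have hsurj : F.Surjective :=
      (hinj.bijective_of_nat_card_le hcard).2
    choose e he using hsurj
    refine ⟨fun ℓ => e ℓ, fun _ ℓ => ⟨(e ℓ).2, ?_⟩⟩
    have := hνadj (e ℓ) (e ℓ).2
    rwa [show ν (e ℓ) = ℓ from congrArg Subtype.val (he ℓ)] at this
  choose τ hτ using hτ
  have hτinj : ∀ b, .inr b ∉ D → (τ b).Injective := fun b hb ℓ ℓ' hℓ =>
    Subtype.ext (𝓗.matching (.inr b) (.inl u) _ (hτ b hb ℓ).1.1 ℓ ℓ.2.1 ℓ' ℓ'.2.1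
      (hτ b hb ℓ).2 (hℓ ▸ (hτ b hb ℓ').2))
  have hadj : ∀ b b', .inr b ∉ D → .inr b' ∉ D → b ≠ b' → ∀ ℓ, 𝓗.H.Adj (τ b ℓ) (τ b' ℓ) :=
    fun b b' hb hb' hbb ℓ => h.adj hm hu' hbb hb hb' (hτ b hb ℓ).1 (hτ b' hb' ℓ).1 ℓ.2
      (hτ b hb ℓ).2.symm (hτ b' hb' ℓ).2.symm
  have hτadj : ∀ b b', .inr b ∉ D → .inr b' ∉ D → b ≠ b' → ∀ ℓ ℓ',
      𝓗.H.Adj (τ b ℓ) (τ b' ℓ') ↔ ℓ = ℓ' := by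
    intro b b' hb hb' hbb ℓ ℓ'
    refine ⟨fun h' => hτinj b' hb' ?_, fun h' => h' ▸ hadj b b' hb hb' hbb ℓ⟩
    exact 𝓗.matching (.inr b) (.inr b') _ (hτ b hb ℓ).1.1 _ (hτ b' hb' ℓ).1.1 _
      (hτ b' hb' ℓ').1.1 (hadj b b' hb hb' hbb ℓ) h'
  have hσ : ∀ v : V, ∃ σ : Λ → W, 𝓗.surplus m D g v < Fintype.card V →
      ∀ ℓ, σ ℓ ∈ 𝓗.free D g (.inl v) ∧ 𝓗.H.Adj (τ a₀ ℓ) (σ ℓ) := by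
    intro v
    by_cases hv : 𝓗.surplus m D g v < Fintype.card V
    · choose σ hσ using fun ℓ => h.exists_adj hm hv ha₀ (hτ a₀ ha₀ ℓ).1
      exact ⟨σ, fun _ => hσ⟩
    · exact ⟨fun ℓ => ℓ, fun h' => absurd h' hv⟩
  choose σ hσ using hσ
  let := Fintype.ofFinite Λ
  rw [Nat.card_eq_fintype_card] at hΛ
  refine ⟨Λ, this, τ, σ, hΛ,
    h.isPartialColoring, h.isRight, fun b hb ℓ => (hτ b hb ℓ).1, hτinj, hτadj,
    fun v hv ℓ => (hσ v hv ℓ).1, fun v hv ℓ ℓ' hℓ => hτinj a₀ ha₀ ?_, fun v hv b hb ℓ ℓ' hℓ => ?_⟩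
  · exact 𝓗.matching (.inl v) (.inr a₀) (σ v ℓ) (hσ v hv ℓ).1.1 _ (hτ a₀ ha₀ ℓ).1.1 _
      (hτ a₀ ha₀ ℓ').1.1 (hσ v hv ℓ).2.symm (hℓ ▸ (hσ v hv ℓ').2.symm)
  · by_cases hb' : a₀ = b
    · subst hb'
      exact hτinj a₀ ha₀ (𝓗.matching (.inl v) (.inr a₀) (σ v ℓ) (hσ v hv ℓ).1.1 _
        (hτ a₀ ha₀ ℓ).1.1 _ (hτ a₀ ha₀ ℓ').1.1 (hσ v hv ℓ).2.symm hℓ)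
    · exact (hτadj a₀ b ha₀ hb hb' ℓ ℓ').1 (h.adj hm hv hb' ha₀ hb (hτ a₀ ha₀ ℓ).1
        (hτ b hb ℓ').1 (hσ v hv ℓ).1 (hσ v hv ℓ).2.symm hℓ)

/-! ### Completing colorings by means of aligned labels. -/

section Aligned

variable {V : Type u} {Y : Type v} [Fintype V] [Fintype Y] [DecidableEq V] [DecidableEq Y]
  {G : SimpleGraph V} {W : Type w} {𝓗 : DPCover (G.join (completeGraph Y)) W}
  {D : Finset (V ⊕ Y)} {g : V ⊕ Y → W} {U : Set V} {Λ : Type w} [Fintype Λ] {τ : Y → Λ → W}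
  {σ : V → Λ → W} {ι : Type*} [Fintype ι]

/-- The coloring that assigns to each vertex outside `D` the color with a prescribed label. -/
def extendByLabels (D : Finset (V ⊕ Y)) (g : V ⊕ Y → W) (τ : Y → Λ → W) (σ : V → Λ → W)
    (ψ : V → Λ) (ρ : Y → Λ) : V ⊕ Y → W :=
  Sum.elim (fun v => σ v (ψ v)) fun b => if .inr b ∈ D then g (.inr b) else τ b (ρ b)

omit [Fintype V] [Fintype Y] [Fintype Λ] in
theorem IsAligned.extendByLabels_eq (h : 𝓗.IsAligned D g U τ σ) (ψ : V → Λ) (ρ : Y → Λ) :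
    ∀ d ∈ D, g d = extendByLabels D g τ σ ψ ρ d := by
  rintro (v | b) hd
  · simpa using h.isRight _ hd
  · simp [extendByLabels, hd]

omit [Fintype V] in
/-- Color the vertices of `U'` by the labels of their color classes and the remaining clique by
the remaining labels. -/
theorem IsAligned.exists_extension [Nonempty Λ] (h : 𝓗.IsAligned D g U τ σ)
    (hcard : Fintype.card Y + Fintype.card ι = Fintype.card Λ + D.card) {φ : ι → Λ}
    (hφ : φ.Injective) (f : V → ι) (U' : Finset V) (hU : ∀ v ∈ U', v ∈ U)
    (hf : ∀ x ∈ U', ∀ y ∈ U', G.Adj x y → ¬ 𝓗.H.Adj (σ x (φ (f x))) (σ y (φ (f y)))) :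
    ∃ ρ : Y → Λ, (∀ b, .inr b ∉ D → ∀ i, φ i ≠ ρ b) ∧
      𝓗.IsPartialColoring (U'.disjSum Finset.univ)
        (extendByLabels D g τ σ (fun v => φ (f v)) ρ) := by
  classical
  obtain ⟨ρ, hρ, hρφ⟩ : ∃ ρ : Y → Λ, (∀ b b', .inr b ∉ D → .inr b' ∉ D → ρ b = ρ b' → b = b') ∧
      ∀ b, .inr b ∉ D → ∀ i, φ i ≠ ρ b := by
    -- Once the class labels are set aside, exactly as many labels remain as there are uncolored
    -- clique vertices.
    have h1 : Fintype.card {b : Y // .inr b ∉ D} ≤ Fintype.card {ℓ : Λ // ℓ ∉ Set.range φ} := by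
      have e1 : Fintype.card {b : Y // .inr b ∈ D} = D.card := by
        rw [Fintype.card_subtype, ← Finset.card_map (f := ⟨Sum.inr, Sum.inr_injective⟩)]
        congr 1
        ext x
        simp only [Finset.mem_map, Finset.mem_filter, Finset.mem_univ, true_and,
          Function.Embedding.coeFn_mk]
        refine ⟨by rintro ⟨b, hb, rfl⟩; exact hb, fun hx => ?_⟩
        obtain ⟨b, rfl⟩ := Sum.isRight_iff.1 (h.isRight x hx)
        exact ⟨b, hx, rfl⟩
      have e2 := Fintype.card_subtype_compl fun b : Y => .inr b ∈ D
      have e3 := Fintype.card_subtype_compl fun ℓ : Λ => ℓ ∈ Set.range φ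
      have e4 : Fintype.card {ℓ : Λ // ℓ ∈ Set.range φ} = Fintype.card ι := by
        rw [← Set.card_range_of_injective hφ]
      have e5 := Fintype.card_le_of_injective _ hφ
      omega
    obtain ⟨F⟩ := Function.Embedding.nonempty_of_card_le h1
    have hR : ∀ b : Y, ∃ ℓ : Λ, ∀ hb : .inr b ∉ D, ℓ = F ⟨b, hb⟩ := by
      intro b
      by_cases hb : (.inr b : V ⊕ Y) ∈ D
      · exact ⟨Classical.arbitrary Λ, fun h' => absurd hb h'⟩
      · exact ⟨F ⟨b, hb⟩, fun _ => rfl⟩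
    choose ρ hρ using hR
    refine ⟨ρ, fun b b' hb hb' hbb => ?_, fun b hb i hi => ?_⟩
    · rw [hρ b hb, hρ b' hb'] at hbb
      exact congrArg Subtype.val (F.injective (Subtype.ext hbb))
    · rw [hρ b hb] at hi
      exact (F ⟨b, hb⟩).2 ⟨i, hi⟩
  refine ⟨ρ, hρφ, ?_, ?_⟩
  · rintro (v | b) hx
    · exact (h.σ_mem v (hU v (by simpa using hx)) _).1
    · by_cases hb : (.inr b : V ⊕ Y) ∈ D
      · rw [← h.extendByLabels_eq _ _ _ hb]
        exact h.isPartialColoring.1 _ hb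
      · simpa [extendByLabels, hb] using (h.τ_mem b hb _).1
  · have key1 : ∀ v ∈ U', ∀ b, ¬ 𝓗.H.Adj (extendByLabels D g τ σ (fun v => φ (f v)) ρ (.inl v))
        (extendByLabels D g τ σ (fun v => φ (f v)) ρ (.inr b)) := by
      intro v hv b
      by_cases hb : (.inr b : V ⊕ Y) ∈ D
      · rw [← h.extendByLabels_eq _ _ _ hb]
        exact (h.σ_mem v (hU v hv) _).2 _ hb
      · simp only [extendByLabels, Sum.elim_inl, Sum.elim_inr, hb, if_false]
        exact fun h' => hρφ b hb _ (h.eq_of_adj v (hU v hv) b hb _ _ h')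
    have key2 : ∀ b b', ¬ 𝓗.H.Adj (extendByLabels D g τ σ (fun v => φ (f v)) ρ (.inr b))
        (extendByLabels D g τ σ (fun v => φ (f v)) ρ (.inr b')) := by
      intro b b'
      by_cases hb : (.inr b : V ⊕ Y) ∈ D <;> by_cases hb' : (.inr b' : V ⊕ Y) ∈ D
      · rw [← h.extendByLabels_eq _ _ _ hb, ← h.extendByLabels_eq _ _ _ hb']
        exact h.isPartialColoring.2 _ hb _ hb'
      · rw [← h.extendByLabels_eq _ _ _ hb]
        simp only [extendByLabels, Sum.elim_inr, hb', if_false]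
        exact fun h' => (h.τ_mem b' hb' _).2 _ hb h'.symm
      · rw [← h.extendByLabels_eq _ _ _ hb']
        simp only [extendByLabels, Sum.elim_inr, hb, if_false]
        exact (h.τ_mem b hb _).2 _ hb'
      · by_cases hbb : b = b'
        · rw [hbb]
          exact 𝓗.H.loopless.irrefl _
        · simp only [extendByLabels, Sum.elim_inr, hb, hb', if_false]
          exact fun h' => hbb (hρ b b' hb hb' ((h.τ_adj b b' hb hb' hbb _ _).1 h'))
    rintro (v | b) hx (v' | b') hy
    · have hv : v ∈ U' := by simpa using hx
      have hv' : v' ∈ U' := by simpa using hy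
      by_cases hvv : G.Adj v v'
      · exact hf v hv v' hv' hvv
      · exact not_adj_of_not_adj (h.σ_mem v (hU v hv) _).1 (h.σ_mem v' (hU v' hv') _).1
          (by simpa using hvv)
    · exact key1 v (by simpa using hx) b'
    · exact fun h' => key1 v' (by simpa using hy) b h'.symm
    · exact key2 b b'

omit [Fintype Y] [DecidableEq Y] in
theorem IsAligned.exists_labeling (h : 𝓗.IsAligned D g U τ σ) (f : V → ι) (i₀ : ι) (ℓ₀ : Λ)
    (F : Finset Λ) (hcard : Fintype.card ι + Fintype.card V * (Fintype.card V - 1) + F.card ≤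
      Fintype.card Λ) :
    ∃ φ : ι → Λ, φ.Injective ∧ φ i₀ = ℓ₀ ∧ (∀ i, i ≠ i₀ → φ i ∉ F) ∧
      ∀ x ∈ U, ∀ y ∈ U, f x ≠ f y → ¬ 𝓗.H.Adj (σ x (φ (f x))) (σ y (φ (f y))) := by
  classical
  obtain ⟨φ, h1, h2, h3, h4⟩ := exists_injective_labeling
    (fun x ℓ y ℓ' => x ∈ U ∧ y ∈ U ∧ 𝓗.H.Adj (σ x ℓ) (σ y ℓ'))
    (fun x ℓ y ℓ₁ ℓ₂ h₁ h₂ => h.σ_inj y h₁.2.1 (𝓗.matching (.inl x) (.inl y) _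
      (h.σ_mem x h₁.1 ℓ).1 _ (h.σ_mem y h₁.2.1 ℓ₁).1 _ (h.σ_mem y h₁.2.1 ℓ₂).1 h₁.2.2 h₂.2.2))
    (fun x ℓ y ℓ' h' => ⟨h'.2.1, h'.1, h'.2.2.symm⟩) f i₀ ℓ₀ F hcard
  exact ⟨φ, h1, h2, h3, fun x hx y hy hxy h' => h4 x y hxy ⟨hx, hy, h'⟩⟩

/-- Since `x₀` has large surplus, `f` need only be proper away from `x₀`. Color `U` by class labels,
then the clique, and leave the large-surplus vertices to the end: they still have enough free colors
to be colored greedily. -/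
theorem IsAligned.isColorable_of_surplus [Finite W] (h : 𝓗.IsAligned D g U τ σ)
    (hcard : Fintype.card Y + Fintype.card ι = Fintype.card Λ + D.card)
    (hbig : D.card + Fintype.card V * Fintype.card V ≤ Fintype.card Y)
    {x₀ : V} (hx₀ : x₀ ∉ U)
    (hU : ∀ v, v ∉ U → Fintype.card V ≤ 𝓗.surplus (Fintype.card Y) D g v)
    (f : V → ι) (hf : ∀ x y, G.Adj x y → x ≠ x₀ → y ≠ x₀ → f x ≠ f y) : 𝓗.IsColorable := by
  classical
  have hmul : Fintype.card V * (Fintype.card V - 1) ≤ Fintype.card V * Fintype.card V :=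
    Nat.mul_le_mul_left _ (Nat.sub_le _ _)
  have hΛ : 0 < Fintype.card Λ := by
    have : 0 < Fintype.card ι := Fintype.card_pos_iff.2 ⟨f x₀⟩
    omega
  have : Nonempty Λ := Fintype.card_pos_iff.1 hΛ
  let ℓ₀ := Classical.arbitrary Λ
  -- The prescribed label plays no role here.
  obtain ⟨φ, hφ, -, -, hφf⟩ := h.exists_labeling f (f x₀) ℓ₀ ∅ (by
    rw [Finset.card_empty]
    omega)
  let U' : Finset V := Finset.univ.filter (· ∈ U)
  have hU' : ∀ v, v ∈ U' ↔ v ∈ U := by simp [U']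
  obtain ⟨ρ, -, hp⟩ := h.exists_extension hcard hφ f U' (fun v => (hU' v).1)
    fun x hx y hy hxy => hφf x ((hU' x).1 hx) y ((hU' y).1 hy)
      (hf x y hxy (ne_of_mem_of_not_mem ((hU' x).1 hx) hx₀)
        (ne_of_mem_of_not_mem ((hU' y).1 hy) hx₀))
  have hDsub : D ⊆ U'.disjSum Finset.univ := fun d hd => by
    obtain ⟨b, rfl⟩ := Sum.isRight_iff.1 (h.isRight d hd)
    simp
  let E : Finset (V ⊕ Y) := (U'ᶜ).disjSum ∅
  have hE : E.card = Fintype.card V - U'.card := by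
    simp [E, Finset.card_compl]
  obtain ⟨g', -, hg'⟩ := hp.exists_greedy E (by
      rw [Finset.disjoint_left]
      rintro (v | b) <;> simp [E]) (by
    rintro (v | b) hv
    · have hvU : v ∉ U := fun h' => by simp [E, hU', h'] at hv
      have h1 := hU v hvU
      have h2 := ncard_free_add_card_le hp hDsub (h.extendByLabels_eq _ ρ) (.inl v)
      rw [Finset.card_disjSum, Finset.card_univ] at h2
      simp only [surplus] at h1
      have h3 := Finset.card_le_univ U'
      omega
    · simp [E] at hv)
  have hun : U'.disjSum Finset.univ ∪ E = Finset.univ := by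
    ext (v | b)
    · simp [E, Classical.em]
    · simp
  rw [hun] at hg'
  exact hg'.isColorable

/-- If `σ x ℓ` and `σ y ℓ` were not adjacent, giving label `ℓ` to the class of `x` would make the
one possibly monochromatic edge harmless, and the cover would be colorable. -/
theorem IsAligned.adj_of_not_isColorable (h : 𝓗.IsAligned D g Set.univ τ σ)
    (hcard : Fintype.card Y + Fintype.card ι = Fintype.card Λ + D.card)
    (hbig : D.card + Fintype.card V * Fintype.card V ≤ Fintype.card Y) (hbad : 𝓗.IsBad)
    {x y : V} (f : V → ι)
    (hf : ∀ a b, G.Adj a b → f a = f b → s(a, b) = s(x, y)) (ℓ : Λ) :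
    𝓗.H.Adj (σ x ℓ) (σ y ℓ) := by
  by_contra hno
  have : Nonempty Λ := ⟨ℓ⟩
  have hmul : Fintype.card V * (Fintype.card V - 1) ≤ Fintype.card V * Fintype.card V :=
    Nat.mul_le_mul_left _ (Nat.sub_le _ _)
  obtain ⟨φ, hφ, hφx, -, hφf⟩ := h.exists_labeling f (f x) ℓ ∅ (by
    rw [Finset.card_empty]
    omega)
  obtain ⟨ρ, -, hp⟩ := h.exists_extension hcard hφ f Finset.univ (fun v _ => Set.mem_univ v)
    fun a _ b _ hab => by
      by_cases hfab : f a = f b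
      · have hs := hf a b hab hfab
        rcases Sym2.eq_iff.1 hs with ⟨rfl, rfl⟩ | ⟨rfl, rfl⟩
        · rwa [← hfab, hφx]
        · rw [hfab, hφx]
          exact fun h' => hno h'.symm
      · exact hφf a (Set.mem_univ a) b (Set.mem_univ b) hfab
  rw [Finset.univ_disjSum_univ] at hp
  exact hbad hp.isColorable

/-- An unlabeled free color `e` could be used at `x`, with the rest colored by labels. Its neighbors
at uncolored clique vertices all carry one label `p`; assigning `p` to the class `f x` keeps the
clique away from it. -/
theorem IsAligned.free_eq_range (h : 𝓗.IsAligned D g Set.univ τ σ)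
    (hcard : Fintype.card Y + Fintype.card ι = Fintype.card Λ + D.card)
    (hbig : D.card + Fintype.card V * Fintype.card V ≤ Fintype.card Y) (hbad : 𝓗.IsBad)
    (hadj : ∀ x y, G.Adj x y → ∀ ℓ, 𝓗.H.Adj (σ x ℓ) (σ y ℓ)) {x : V}
    (hfree : ∀ {b b' : Y}, b ≠ b' → .inr b ∉ D → .inr b' ∉ D → ∀ {ℓ ℓ' : Λ}, ∀ e ∈
      𝓗.free D g (.inl x), 𝓗.H.Adj e (τ b ℓ) → 𝓗.H.Adj e (τ b' ℓ') → 𝓗.H.Adj (τ b ℓ) (τ b' ℓ'))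
    (f : V → ι) (hf : ∀ a b, G.Adj a b → a ≠ x → b ≠ x → f a ≠ f b) :
    𝓗.free D g (.inl x) ⊆ Set.range (σ x) := by
  classical
  intro e he
  by_contra hno
  have hΛ : 0 < Fintype.card Λ := by
    have : 0 < Fintype.card ι := Fintype.card_pos_iff.2 ⟨f x⟩
    omega
  have : Nonempty Λ := Fintype.card_pos_iff.1 hΛ
  let ℓ₁ := Classical.arbitrary Λ
  obtain ⟨p, hp⟩ : ∃ p : Λ, ∀ b, .inr b ∉ D → ∀ ℓ, 𝓗.H.Adj e (τ b ℓ) → ℓ = p := by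
    by_cases hex : ∃ b, .inr b ∉ D ∧ ∃ p, 𝓗.H.Adj e (τ b p)
    · obtain ⟨b, hb, p, hbp⟩ := hex
      refine ⟨p, fun b' hb' ℓ hℓ => ?_⟩
      by_cases hbb : b' = b
      · subst hbb
        exact h.τ_inj b' hb (𝓗.matching (.inl x) (.inr b') e he.1 _ (h.τ_mem b' hb ℓ).1 _
          (h.τ_mem b' hb p).1 hℓ hbp)
      · exact (h.τ_adj b' b hb' hb hbb ℓ p).1 (hfree hbb hb' hb e he hℓ hbp)
    · exact ⟨ℓ₁, fun b hb ℓ hℓ => absurd ⟨b, hb, ℓ, hℓ⟩ hex⟩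
  -- The labels under which some other vertex of `G` would conflict with `e`, at most one per
  -- vertex. Classes other than `f x` avoid them.
  let F : Finset Λ := (Finset.univ.erase x).biUnion
    fun v => Finset.univ.filter fun ℓ => 𝓗.H.Adj (σ v ℓ) e
  have hF : F.card ≤ Fintype.card V - 1 := by
    refine (Finset.card_biUnion_le_card_mul _ _ 1 fun v _ => ?_).trans ?_
    · rw [Finset.card_le_one]
      intro b hb b' hb'
      exact h.σ_inj v (Set.mem_univ v) (𝓗.matching (.inl x) (.inl v) e he.1 _
        (h.σ_mem v (Set.mem_univ v) b).1 _ (h.σ_mem v (Set.mem_univ v) b').1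
        (Finset.mem_filter.1 hb).2.symm (Finset.mem_filter.1 hb').2.symm)
    · rw [mul_one, Finset.card_erase_of_mem (Finset.mem_univ x), Finset.card_univ]
  have hmul : Fintype.card V * (Fintype.card V - 1) + Fintype.card V ≤
      Fintype.card V * Fintype.card V := by
    have : 0 < Fintype.card V := Fintype.card_pos_iff.2 ⟨x⟩
    rw [Nat.mul_sub_one]
    exact (Nat.sub_add_cancel (Nat.le_mul_of_pos_left _ this)).le
  obtain ⟨φ, hφ, hφx, hφF, hφf⟩ := h.exists_labeling f (f x) p F (by omega)
  obtain ⟨ρ, hρ, hpc⟩ := h.exists_extension hcard hφ f (Finset.univ.erase x)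
    (fun v _ => Set.mem_univ v) fun a ha b hb hab => hφf a (Set.mem_univ a) b (Set.mem_univ b)
      (hf a b hab (Finset.ne_of_mem_erase ha) (Finset.ne_of_mem_erase hb))
  have hx : (.inl x : V ⊕ Y) ∉ (Finset.univ.erase x).disjSum (Finset.univ : Finset Y) := by simp
  have hex : e ∈ 𝓗.free ((Finset.univ.erase x).disjSum Finset.univ)
      (extendByLabels D g τ σ (fun v => φ (f v)) ρ) (.inl x) := by
    refine ⟨he.1, ?_⟩
    rintro (v | b) hd
    · have hvx : v ≠ x := by simpa using hd
      intro h'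
      change 𝓗.H.Adj e (σ v (φ (f v))) at h'
      -- Within the class `f x`, the color `σ v p` of a neighbor `v` is already matched to `σ x p`,
      -- so adjacency to `e` would force `e = σ x p`.
      by_cases hfv : f v = f x
      · rw [hfv, hφx] at h'
        have hG : G.Adj x v := by
          simpa using 𝓗.adj_of_adj (.inl x) (.inl v) e he.1 _ (h.σ_mem v (Set.mem_univ v) p).1 h'
        exact hno ⟨p, 𝓗.matching (.inl v) (.inl x) (σ v p) (h.σ_mem v (Set.mem_univ v) p).1 _
          (h.σ_mem x (Set.mem_univ x) p).1 e he.1 (hadj x v hG p).symm h'.symm⟩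
      · exact hφF _ hfv (Finset.mem_biUnion.2 ⟨v, by simpa using hvx,
          Finset.mem_filter.2 ⟨Finset.mem_univ _, h'.symm⟩⟩)
    · by_cases hb : (.inr b : V ⊕ Y) ∈ D
      · rw [← h.extendByLabels_eq _ _ _ hb]
        exact he.2 _ hb
      · simp only [extendByLabels, Sum.elim_inr, hb, if_false]
        exact fun h' => hρ b hb (f x) (hφx.trans (hp b hb _ h').symm)
  have hfin := hpc.insert_update hx hex
  have hun : insert (.inl x) ((Finset.univ.erase x).disjSum (Finset.univ : Finset Y)) =
      Finset.univ := by
    ext (v | b)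
    · simp [Classical.em]
    · simp
  rw [hun] at hfin
  exact hbad hfin.isColorable

end Aligned

/-! ### From labels to canonicity, and the case of positive surplus. -/

/-- By counting, the labels exhaust each list. The edges between equal labels then form a perfect
matching, which leaves no room for other edges. -/
theorem isCanonical_of_labels {X : Type u} {J : SimpleGraph X} {W : Type w} [Finite W]
    {𝓗 : DPCover J W} {m : ℕ} (hm : 𝓗.IsFold m) {Λ : Type*} [Fintype Λ]
    (hΛ : Fintype.card Λ = m) (s : X → Λ → W) (hs : ∀ x ℓ, s x ℓ ∈ 𝓗.L x)
    (hinj : ∀ x, (s x).Injective) (hadj : ∀ x y, J.Adj x y → ∀ ℓ, 𝓗.H.Adj (s x ℓ) (s y ℓ)) :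
    𝓗.IsCanonical m := by
  classical
  have hsurj : ∀ x, ∀ c ∈ 𝓗.L x, ∃ ℓ, s x ℓ = c := by
    intro x
    have h1 : Set.range (s x) = 𝓗.L x := by
      refine Set.eq_of_subset_of_ncard_le (by rintro _ ⟨ℓ, rfl⟩; exact hs x ℓ) ?_ (Set.toFinite _)
      rw [hm.ncard_eq, ← Set.image_univ, Set.ncard_image_of_injective _ (hinj x),
        Set.ncard_univ, Nat.card_eq_fintype_card, hΛ]
    exact fun c hc => h1.symm.subset hc
  have hex : ∀ c, ∃ ℓ, ∃ x, s x ℓ = c := fun c => by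
    obtain ⟨x, hx⟩ := Set.mem_iUnion.1 (𝓗.cover.symm.subset (Set.mem_univ c))
    obtain ⟨ℓ, hℓ⟩ := hsurj x c hx
    exact ⟨ℓ, x, hℓ⟩
  choose lab hlab using hex
  have hlab' : ∀ x ℓ, lab (s x ℓ) = ℓ := fun x ℓ => by
    obtain ⟨y, hy⟩ := hlab (s x ℓ)
    have hxy : y = x := eq_of_mem_of_mem (c := s x ℓ) (by
      rw [← hy]
      exact hs y _) (hs x ℓ)
    subst hxy
    exact hinj y hy
  let e : Λ ≃ Fin m := Fintype.equivFinOfCardEq hΛ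
  refine ⟨hm, fun c => e (lab c), fun x => ⟨fun _ _ => Set.mem_univ _, ?_, ?_⟩, ?_⟩
  · intro c hc d hd hcd
    obtain ⟨ℓ, rfl⟩ := hsurj x c hc
    obtain ⟨ℓ', rfl⟩ := hsurj x d hd
    have := e.injective hcd
    rw [hlab', hlab'] at this
    rw [this]
  · intro i _
    exact ⟨s x (e.symm i), hs x _, by simp [hlab']⟩
  · intro x y hxy c hc d hd
    obtain ⟨ℓ, rfl⟩ := hsurj x c hc
    obtain ⟨ℓ', rfl⟩ := hsurj y d hd
    simp only [hlab', e.apply_eq_iff_eq]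
    refine ⟨fun h => hinj y (𝓗.matching x y _ hc _ (hs y ℓ) _ hd (hadj x y hxy ℓ) h), ?_⟩
    rintro rfl
    exact hadj x y hxy ℓ

/-- If every vertex of `G` has positive surplus, then a partial coloring of the clique can be
extended using the colorability of `G` with respect to `k`-fold covers. -/
theorem IsPartialColoring.isColorable_of_surplus_pos {V : Type u} {Y : Type v} [Fintype V]
    [Fintype Y] [DecidableEq V] [DecidableEq Y] {G : SimpleGraph V} {W : Type w} [Finite W]
    {𝓗 : DPCover (G.join (completeGraph Y)) W} {m k : ℕ} (hm : 𝓗.IsFold m) (hk : 1 ≤ k)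
    (hmk : m + 1 = Fintype.card Y + k) (hG : IsDPColorable.{u, w} G k) {D : Finset (V ⊕ Y)}
    {g : V ⊕ Y → W} (h : 𝓗.IsPartialColoring D g) (hD : ∀ x ∈ D, x.isRight)
    (hpos : ∀ v, 0 < 𝓗.surplus m D g v) : 𝓗.IsColorable := by
  classical
  let A : Finset (V ⊕ Y) := (∅ : Finset V).disjSum Finset.univ
  have hDA : D ⊆ A := fun d hd => by
    obtain ⟨b, rfl⟩ := Sum.isRight_iff.1 (hD d hd)
    simp [A]
  have hA : A.card = Fintype.card Y := by simp [A]
  have hAD := Finset.card_sdiff_add_card_eq_card hDA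
  obtain ⟨g', hg, hp⟩ := h.exists_greedy (A \ D) Finset.disjoint_sdiff fun x _ => by
    have := ncard_list_le h x
    rw [hm.ncard_eq] at this
    omega
  rw [Finset.union_sdiff_of_subset hDA] at hp
  -- With the whole clique colored, positive surplus gives at least m + 1 - t = k free colors.
  -- Trimming to exactly k yields a k-fold cover of `G`.
  have hF : ∀ v, ∃ F ⊆ 𝓗.free A g' (.inl v), F.encard = k := fun v => by
    refine Set.exists_subset_encard_eq ?_
    rw [← Set.Finite.cast_ncard_eq (Set.toFinite _), Nat.cast_le]
    have h1 := ncard_free_add_card_le hp hDA hg (.inl v)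
    have h2 := hpos v
    simp only [surplus] at h2
    omega
  choose F hFsub hF using hF
  let 𝓖 : DPCover G {c : W // ∃ v, c ∈ F v} :=
    { H := 𝓗.H.comap Subtype.val
      L := fun v => Subtype.val ⁻¹' F v
      disjoint := fun x y hxy => Set.disjoint_left.2 fun c hx hy => hxy
        (Sum.inl_injective (eq_of_mem_of_mem (hFsub x hx).1 (hFsub y hy).1))
      indep := fun x c hc d hd hcd => 𝓗.indep (.inl x) (hFsub x hc).1 (hFsub x hd).1
        (fun h' => hcd (Subtype.ext h'))
      cover := Set.eq_univ_of_forall fun c => Set.mem_iUnion.2 c.2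
      adj_of_adj := fun x y c hc d hd h' => by
        simpa using 𝓗.adj_of_adj (.inl x) (.inl y) c (hFsub x hc).1 d (hFsub y hd).1 h'
      matching := fun x y c hc d hd d' hd' h₁ h₂ => Subtype.ext
        (𝓗.matching (.inl x) (.inl y) c (hFsub x hc).1 d (hFsub y hd).1 d' (hFsub y hd').1 h₁ h₂) }
  have hfold : 𝓖.IsFold k := fun x => by
    rw [← hF x]
    exact Set.encard_preimage_of_injective_subset_range Subtype.val_injective
      fun c hc => ⟨⟨c, x, hc⟩, rfl⟩
  obtain ⟨T, hT, hTx⟩ := hG _ 𝓖 hfold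
  choose c hc _ using hTx
  have hcfree : ∀ v, (c v).1 ∈ 𝓗.free A g' (.inl v) := fun v => hFsub v (hc v).2
  have hall : 𝓗.IsPartialColoring Finset.univ
      (Sum.elim (fun v => (c v).1) fun b => g' (.inr b)) := by
    refine ⟨?_, ?_⟩
    · rintro (v | b) _
      · exact (hcfree v).1
      · exact hp.1 (.inr b) (by simp [A])
    · rintro (v | b) _ (v' | b') _
      · intro h'
        exact hT (hc v).1 (hc v').1 (fun e => by simp [e] at h') h'
      · exact (hcfree v).2 (.inr b') (by simp [A])
      · exact fun h' => (hcfree v').2 (.inr b) (by simp [A]) h'.symm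
      · exact hp.2 (.inr b) (by simp [A]) (.inr b') (by simp [A])
  exact hall.isColorable

end DPCover

theorem isDPColorable_of_dpChromaticNumber_eq {V : Type u} {G : SimpleGraph V} {k : ℕ}
    (h : dpChromaticNumber.{u, w} G = k) : IsDPColorable.{u, w} G k := by
  have hne : {k : ℕ | IsDPColorable.{u, w} G k}.Nonempty := by
    by_contra hempty
    rw [Set.not_nonempty_iff_eq_empty] at hempty
    simp [dpChromaticNumber, hempty] at h
  rw [dpChromaticNumber, ← ENat.natCast_sInf hne, Nat.cast_inj] at h
  rw [← h]
  exact Nat.sInf_mem hne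

/-! ### Criticality of the join. -/

section Critical

variable {V : Type u} {G : SimpleGraph V} {k : ℕ}

theorem IsCritical.one_le [Nonempty V] (h : G.IsCritical k) : 1 ≤ k := by
  rw [Nat.one_le_iff_ne_zero]
  rintro rfl
  have h1 : G.Colorable 0 := chromaticNumber_le_iff_colorable.1 h.1.le
  obtain ⟨C⟩ := h1
  exact (C (Classical.arbitrary V)).elim0

theorem IsCritical.colorable_coe [Nonempty V] (h : G.IsCritical k) {G' : G.Subgraph}
    (hG' : G' ≠ ⊤) : G'.coe.Colorable (k - 1) := by
  have h1 := h.2 G' hG'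
  have h2 := h.one_le
  rw [← chromaticNumber_le_iff_colorable]
  refine Order.le_of_lt_add_one ?_
  rwa [← ENat.natCast_one, ← ENat.natCast_add, Nat.sub_add_cancel h2]

theorem IsCritical.exists_coloring_of_adj [Nonempty V] (h : G.IsCritical k) {x y : V}
    (hxy : G.Adj x y) :
    ∃ f : V → Fin (k - 1), ∀ a b, G.Adj a b → f a = f b → s(a, b) = s(x, y) := by
  have hne : (⊤ : G.Subgraph).deleteEdges {s(x, y)} ≠ ⊤ := fun h' => by
    have : ((⊤ : G.Subgraph).deleteEdges {s(x, y)}).Adj x y := by rw [h']; exact hxy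
    simp at this
  obtain ⟨C⟩ := h.colorable_coe hne
  refine ⟨fun v => C ⟨v, Set.mem_univ v⟩, fun a b hab hf => ?_⟩
  by_contra hs
  refine C.valid (v := ⟨a, Set.mem_univ a⟩) (w := ⟨b, Set.mem_univ b⟩) ?_ hf
  change G.Adj a b ∧ s(a, b) ∉ _
  exact ⟨hab, hs⟩

theorem IsCritical.exists_coloring_compl [Nonempty V] (h : G.IsCritical k) (x : V) :
    ∃ f : {v // v ≠ x} → Fin (k - 1), ∀ a b, G.Adj a.1 b.1 → f a ≠ f b := by
  have hne : (⊤ : G.Subgraph).deleteVerts {x} ≠ ⊤ := fun h' => by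
    have : x ∈ ((⊤ : G.Subgraph).deleteVerts {x}).verts := by rw [h']; trivial
    simp at this
  obtain ⟨C⟩ := h.colorable_coe hne
  refine ⟨fun v => C ⟨v, by simpa using v.2⟩, fun a b hab => C.valid ?_⟩
  simpa [hab] using ⟨a.2, b.2⟩

/-- The vertex `u` only provides a default color for `x`, since `Fin (k - 1)` might otherwise be
empty. -/
theorem IsCritical.exists_coloring_of_ne [Nonempty V] (h : G.IsCritical k) {x u : V}
    (hux : u ≠ x) :
    ∃ f : V → Fin (k - 1), ∀ a b, G.Adj a b → a ≠ x → b ≠ x → f a ≠ f b := by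
  classical
  obtain ⟨f, hf⟩ := h.exists_coloring_compl x
  refine ⟨fun v => if hv : v ≠ x then f ⟨v, hv⟩ else f ⟨u, hux⟩, fun a b hab ha hb => ?_⟩
  simpa only [dif_pos ha, dif_pos hb] using hf ⟨a, ha⟩ ⟨b, hb⟩ hab

/-- One color is saved at the edge `pq`: inside `G` by criticality, across the join by coloring `G`
minus a vertex and giving that vertex the color of its clique neighbor, and inside the clique by
merging the two colors. -/
theorem IsCritical.exists_join_coloring [Nonempty V] (h : G.IsCritical k) {t : ℕ}
    {p q : V ⊕ Fin t} (hpq : (G.join (completeGraph (Fin t))).Adj p q) :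
    ∃ (α : Type) (_ : Fintype α) (f : V ⊕ Fin t → α), Fintype.card α = k + t - 1 ∧
      ∀ a b, (G.join (completeGraph (Fin t))).Adj a b → f a = f b → s(a, b) = s(p, q) := by
  classical
  have hk := h.one_le
  have hcross : ∀ x c, ∃ (α : Type) (_ : Fintype α) (f : V ⊕ Fin t → α),
      Fintype.card α = k + t - 1 ∧ ∀ a b, (G.join (completeGraph (Fin t))).Adj a b → f a = f b →
        s(a, b) = s(.inl x, .inr c) := by
    intro x c
    obtain ⟨f, hf⟩ := h.exists_coloring_compl x
    refine ⟨Fin (k - 1) ⊕ Fin t, inferInstance,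
      Sum.elim (fun v => if hv : v ≠ x then .inl (f ⟨v, hv⟩) else .inr c) .inr,
      by simp; omega, ?_⟩
    rintro (a | a) (b | b) hab hfab
    · by_cases ha : a = x <;> by_cases hb : b = x
      · subst ha hb
        simp at hab
      · simp [ha, hb] at hfab
      · simp [ha, hb] at hfab
      · simp only [Sum.elim_inl, ne_eq, ha, hb, not_false_eq_true, dif_pos, Sum.inl.injEq] at hfab
        exact absurd hfab (hf ⟨a, ha⟩ ⟨b, hb⟩ (by simpa using hab))
    · by_cases ha : a = x
      · have : c = b := by simpa [ha] using hfab
        rw [ha, this]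
      · simp [ha] at hfab
    · by_cases hb : b = x
      · have : a = c := by simpa [hb] using hfab
        rw [hb, this, Sym2.eq_swap]
      · simp [hb] at hfab
    · simp_all
  rcases p with x | c <;> rcases q with y | d
  · obtain ⟨f, hf⟩ := h.exists_coloring_of_adj (by simpa using hpq : G.Adj x y)
    refine ⟨Fin (k - 1) ⊕ Fin t, inferInstance, Sum.map f id, by simp; omega, ?_⟩
    rintro (a | a) (b | b) hab hfab
    · have := hf a b (by simpa using hab) (by simpa using hfab)
      simpa using this
    · simp at hfab
    · simp at hfab
    · simp_all
  · exact hcross x d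
  · rw [Sym2.eq_swap]
    exact hcross y c
  · have hcd : c ≠ d := by simpa using hpq
    obtain ⟨C⟩ := chromaticNumber_le_iff_colorable.1 h.1.le
    refine ⟨Fin k ⊕ {e : Fin t // e ≠ c}, inferInstance, Sum.map C fun e =>
      if he : e ≠ c then ⟨e, he⟩ else ⟨d, hcd.symm⟩, ?_, ?_⟩
    · have := c.pos
      simp [Fintype.card_subtype_compl]
      omega
    rintro (a | a) (b | b) hab hfab
    · exact absurd (by simpa using hfab) (C.valid (by simpa using hab : G.Adj a b))
    · simp at hfab
    · simp at hfab
    · have hne : a ≠ b := by simpa using hab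
      by_cases ha : a = c <;> by_cases hb : b = c
      · exact absurd (ha.trans hb.symm) hne
      · have : d = b := by simpa [ha, hb] using hfab
        rw [ha, this]
      · have : a = d := by simpa [ha, hb] using hfab
        rw [hb, this, Sym2.eq_swap]
      · exact absurd (by simpa [ha, hb] using hfab) hne

theorem Colorable.of_join [Nonempty V] {t n : ℕ}
    (h : (G.join (completeGraph (Fin t))).Colorable n) : G.Colorable (n - t) := by
  classical
  obtain ⟨C⟩ := h
  have hinj : Function.Injective fun b : Fin t => C (.inr b) := fun a b hab => by
    by_contra hne
    exact C.valid (by simpa using hne) hab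
  let S := Set.range fun b : Fin t => C (.inr b)
  have hcard : Fintype.card {i : Fin n // i ∉ S} = n - t := by
    rw [Fintype.card_subtype_compl, Fintype.card_fin]
    congr 1
    exact (Set.card_range_of_injective hinj).trans (Fintype.card_fin t)
  rw [← hcard]
  exact (Coloring.mk (fun v => (⟨C (.inl v), by
    rintro ⟨b, hb⟩
    exact C.valid (by simp : (G.join (completeGraph (Fin t))).Adj (.inr b) (.inl v)) hb⟩ :
    {i : Fin n // i ∉ S})) fun {a b} hab hC => C.valid
      (by simpa using hab : (G.join (completeGraph (Fin t))).Adj (.inl a) (.inl b))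
      (congrArg Subtype.val hC)).colorable

theorem Colorable.join {t : ℕ} (h : G.Colorable k) :
    (G.join (completeGraph (Fin t))).Colorable (k + t) := by
  obtain ⟨C⟩ := h
  have := (Coloring.mk (G := G.join (completeGraph (Fin t))) (Sum.map C id) (by
    rintro (a | a) (b | b) hab hC
    · exact C.valid (by simpa using hab : G.Adj a b) (by simpa using hC)
    · simp at hC
    · simp at hC
    · simp_all)).colorable
  simpa using this

theorem IsCritical.join [Nonempty V] (h : G.IsCritical k) {t : ℕ} (ht : 0 < t) :
    (G.join (completeGraph (Fin t))).IsCritical (k + t) := by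
  have hk := h.one_le
  refine ⟨le_antisymm ?_ ?_, fun J hJ => ?_⟩
  · exact chromaticNumber_le_iff_colorable.2 (chromaticNumber_le_iff_colorable.1 h.1.le).join
  · by_contra! hlt
    obtain ⟨n, hn⟩ := ENat.ne_top_iff_exists.1 hlt.ne_top
    rw [← hn, Nat.cast_lt] at hlt
    have := (chromaticNumber_le_iff_colorable.1 hn.ge).of_join
    rw [← chromaticNumber_le_iff_colorable, h.1, Nat.cast_le] at this
    omega
  -- The join has no isolated vertices, both sides being nonempty, so a proper subgraph always
  -- misses an edge.
  · obtain ⟨p, q, hpq, hJpq⟩ : ∃ p q, (G.join (completeGraph (Fin t))).Adj p q ∧ ¬ J.Adj p q := by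
      by_contra! hall
      refine hJ (Subgraph.ext (Set.eq_univ_of_forall ?_) ?_)
      · rintro (v | b)
        · exact J.edge_vert (hall (.inl v) (.inr ⟨0, ht⟩) (by simp))
        · exact J.edge_vert (hall (.inr b) (.inl (Classical.arbitrary V)) (by simp))
      · ext a b
        exact ⟨fun h' => J.adj_sub h', fun h' => hall a b h'⟩
    obtain ⟨α, _, f, hα, hf⟩ := h.exists_join_coloring hpq
    have hC := (Coloring.mk (G := J.coe) (fun v => f v.1) fun {a b} hab hfab => by
      have hab' : J.Adj a b := hab
      rcases Sym2.eq_iff.1 (hf a b (J.adj_sub hab') hfab) with ⟨ha, hb⟩ | ⟨ha, hb⟩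
      · exact hJpq (ha ▸ hb ▸ hab')
      · exact hJpq (ha ▸ hb ▸ hab'.symm)).colorable
    rw [hα, ← chromaticNumber_le_iff_colorable] at hC
    refine hC.trans_lt ?_
    rw [Nat.cast_lt]
    omega

end Critical

/-! ### Bad covers of the join are canonical. -/

/-- For n ≥ 1 the slack in the extreme case is n(n - 1)(n - 2). -/
theorem two_mul_add_sq_le_cube {n d : ℕ} (hd : d ≤ 2 * ((n - 1) * n)) : d + n * n ≤ n ^ 3 := by
  rcases n with _ | _ | n
  · simpa using hd
  · simpa using hd
  · refine (Nat.add_le_add_right hd _).trans ?_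
    simp only [Nat.add_sub_cancel]
    ring_nf
    nlinarith [Nat.zero_le n, Nat.zero_le (n ^ 2), Nat.zero_le (n ^ 3)]

theorem DPCover.isCanonical_of_isBad {V : Type u} [Fintype V] [Nonempty V] {G : SimpleGraph V}
    {k t : ℕ} (hcrit : G.IsCritical k) (hDP : IsDPColorable.{u, w} G k)
    (ht : Fintype.card V ^ 3 ≤ t) {W : Type w} {𝓗 : DPCover (G.join (completeGraph (Fin t))) W}
    (hm : 𝓗.IsFold (k + t - 1)) (hbad : 𝓗.IsBad) : 𝓗.IsCanonical (k + t - 1) := by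
  classical
  have hk := hcrit.one_le
  have hV : 0 < Fintype.card V := Fintype.card_pos
  have ht0 : 0 < t := (Nat.pow_pos hV).trans_le ht
  have : Finite W := hm.finite
  have : Nonempty W := by
    have h1 := hm.ncard_eq (.inr ⟨0, ht0⟩)
    obtain ⟨c, -⟩ := (Set.ncard_pos (Set.toFinite _)).1
      (show 0 < (𝓗.L (.inr ⟨0, ht0⟩)).ncard by omega)
    exact ⟨c⟩
  obtain ⟨D, g, hsat⟩ := 𝓗.exists_isSaturated (k + t - 1)
  obtain ⟨u, hu⟩ : ∃ u, 𝓗.surplus (k + t - 1) D g u = 0 := by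
    by_contra! hpos
    exact hbad (hsat.isPartialColoring.isColorable_of_surplus_pos hm hk
      (by rw [Fintype.card_fin]; omega) hDP hsat.isRight fun v => Nat.pos_of_ne_zero (hpos v))
  have hbig : D.card + Fintype.card V * Fintype.card V ≤ Fintype.card (Fin t) := by
    rw [Fintype.card_fin]
    exact (two_mul_add_sq_le_cube (hsat.card_le.trans
      (Nat.mul_le_mul_left 2 (totalSurplus_le_of_surplus_eq_zero hu)))).trans ht
  obtain ⟨a₀, ha₀⟩ : ∃ a₀ : Fin t, .inr a₀ ∉ D := by
    by_contra! hall
    have h1 := Finset.card_le_card (s := Finset.univ.map ⟨Sum.inr, Sum.inr_injective⟩) (t := D)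
      fun x hx => by
        obtain ⟨b, -, rfl⟩ := Finset.mem_map.1 hx
        exact hall b
    rw [Finset.card_map, Finset.card_univ] at h1
    have := Nat.mul_pos hV hV
    omega
  obtain ⟨Λ, _, τ, σ, hΛ, hal⟩ := hsat.exists_isAligned hm hu ha₀
  have hcard : Fintype.card (Fin t) + Fintype.card (Fin (k - 1)) = Fintype.card Λ + D.card := by
    rw [Fintype.card_fin, Fintype.card_fin]
    omega
  have hlt : ∀ v, 𝓗.surplus (k + t - 1) D g v < Fintype.card V := by
    by_contra! hx
    obtain ⟨x, hx⟩ := hx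
    have hux : u ≠ x := by
      rintro rfl
      omega
    obtain ⟨f, hf⟩ := hcrit.exists_coloring_of_ne hux
    refine hbad (hal.isColorable_of_surplus hcard hbig (x₀ := x) (by simpa using hx)
      (fun v hv => ?_) f hf)
    have hv' : Fintype.card V ≤ 𝓗.surplus (k + t - 1) D g v := by simpa using hv
    refine hv'.trans ?_
    -- Replacing m = k + t - 1 by t does not lower the surplus, as k ≥ 1.
    simp only [surplus, Fintype.card_fin]
    omega
  have huniv : {v | 𝓗.surplus (k + t - 1) D g v < Fintype.card V} = Set.univ :=
    Set.eq_univ_of_forall hlt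
  rw [huniv] at hal
  have hadj : ∀ x y, G.Adj x y → ∀ ℓ, 𝓗.H.Adj (σ x ℓ) (σ y ℓ) := fun x y hxy ℓ => by
    obtain ⟨f, hf⟩ := hcrit.exists_coloring_of_adj hxy
    exact hal.adj_of_not_isColorable hcard hbig hbad f hf ℓ
  have hzero : ∀ x, 𝓗.surplus (k + t - 1) D g x = 0 := by
    intro x
    by_cases hux : u = x
    · rwa [← hux]
    obtain ⟨f, hf⟩ := hcrit.exists_coloring_of_ne hux
    have h1 := hal.free_eq_range hcard hbig hbad hadj (x := x)
      (fun {b b'} hbb hb hb' {ℓ ℓ'} e he h₁ h₂ => hsat.adj hm (hlt x) hbb hb hb' (hal.τ_mem _ hb ℓ)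
        (hal.τ_mem _ hb' ℓ') he h₁ h₂) f hf
    have h2 := Set.ncard_le_ncard h1 (Set.toFinite _)
    rw [← Set.image_univ, Set.ncard_image_of_injective _ (hal.σ_inj x (Set.mem_univ x)),
      Set.ncard_univ, Nat.card_eq_fintype_card] at h2
    simp only [surplus]
    omega
  -- The bound |D| ≤ 2 · (total surplus) now reads |D| ≤ 0, so the labels cover entire lists.
  have hD : D = ∅ := by
    have := hsat.card_le
    rw [totalSurplus, Finset.sum_eq_zero fun v _ => by rw [hzero v, Nat.zero_min]] at this
    exact Finset.card_eq_zero.1 (by omega)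
  subst hD
  have hσ : ∀ x, ∀ γ ∈ 𝓗.L (.inl x), ∃ ℓ, σ x ℓ = γ := by
    intro x
    have h1 : Set.range (σ x) = 𝓗.L (.inl x) := by
      refine Set.eq_of_subset_of_ncard_le ?_ ?_ (Set.toFinite _)
      · rintro _ ⟨ℓ, rfl⟩
        exact (hal.σ_mem x (Set.mem_univ x) ℓ).1
      · rw [hm.ncard_eq, ← Set.image_univ,
          Set.ncard_image_of_injective _ (hal.σ_inj x (Set.mem_univ x)),
          Set.ncard_univ, Nat.card_eq_fintype_card, ← hΛ, Finset.card_empty, add_zero]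
    exact fun c hc => h1.symm.subset hc
  have hcross : ∀ x b ℓ, 𝓗.H.Adj (σ x ℓ) (τ b ℓ) := by
    intro x b ℓ
    have hb : (.inr b : V ⊕ Fin t) ∉ (∅ : Finset (V ⊕ Fin t)) := Finset.notMem_empty _
    obtain ⟨γ, hγ, hγadj⟩ := hsat.exists_adj hm (hlt x) hb (hal.τ_mem b hb ℓ)
    obtain ⟨ℓ', rfl⟩ := hσ x γ hγ.1
    rw [hal.eq_of_adj x (Set.mem_univ x) b hb ℓ' ℓ hγadj.symm] at hγadj
    exact hγadj.symm
  refine isCanonical_of_labels hm (by simpa using hΛ) (Sum.elim σ τ) ?_ ?_ ?_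
  · rintro (x | b) ℓ
    · exact (hal.σ_mem x (Set.mem_univ x) ℓ).1
    · exact (hal.τ_mem b (Finset.notMem_empty _) ℓ).1
  · rintro (x | b)
    · exact hal.σ_inj x (Set.mem_univ x)
    · exact hal.τ_inj b (Finset.notMem_empty _)
  · rintro (x | b) (y | c) hxy ℓ
    · exact hadj x y (by simpa using hxy) ℓ
    · exact hcross x c ℓ
    · exact (hcross y b ℓ).symm
    · exact (hal.τ_adj b c (Finset.notMem_empty _) (Finset.notMem_empty _)
        (by simpa using hxy) ℓ ℓ).2 rfl

end SimpleGraph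

theorem mainTheorem2 {V : Type u} [Fintype V] [Nonempty V] (G : SimpleGraph V) (n k : ℕ)
    (hn : Fintype.card V = n) (hcrit : G.IsCritical k)
    (hDP : SimpleGraph.dpChromaticNumber.{u, w} G = (k : ℕ∞)) (t : ℕ) (ht : n ^ 3 ≤ t) :
    SimpleGraph.IsRobustlyCritical.{u, w}
      (SimpleGraph.join G (SimpleGraph.completeGraph (Fin t))) := by
  subst hn
  have ht0 : 0 < t := (Nat.pow_pos Fintype.card_pos).trans_le ht
  exact ⟨k + t, by omega, hcrit.join ht0, fun W 𝓗 hm hbad =>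
    SimpleGraph.DPCover.isCanonical_of_isBad hcrit
      (SimpleGraph.isDPColorable_of_dpChromaticNumber_eq hDP) ht hm hbad⟩
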